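/- Let $R_{n,k}$ be the set of restricted growth sequences of length $n$ with exactly $k$ different letters, i.e. sequences $\pi=\pi_1\cdots\pi_n$ of positive integers with $\pi_1=1$ and $\pi_{j+1}\le 1+\max\{\pi_1,\dots,\pi_j\}$ for $1\le j<n$, and $|\{\pi_1,\dots,\pi_n\}|=k$. Let $V_\pi$ be the number of pairs $i<j$ with $\pi_\ell<\min\{\pi_i,\pi_j\}$ for all $i<\ell<j$, let $E(V_\pi\mid \pi\in R_{n,k})$ be the mean of $V_\pi$ over the uniform distribution on $R_{n,k}$ (read as $0$ if $R_{n,k}=\emptyset$), and let $S_{n,k}$ be the Stirling numbers of the second kind. Then the double series $$Q(x,y)=\sum_{k\ge1}y^k\sum_{n\ge0}\frac{x^n}{n!}\,S_{n,k}\,E(V_\pi\mid\pi\in R_{n,k})$$ converges absolutely for all $x,y\in\mathbb C$. Put $Ei(1,z)=\int_1^\infty \frac{e^{-zt}}{t}\,dt$ for $\operatorname{Re}z>0$ and $$\begin{aligned}T(x,y)={}&y^3\int_0^x(x-t)e^{ye^t-y}\int_0^tEi(1,ye^r)e^{ye^r+2r}\,dr\,dt\\&+y\int_0^x(t-x)e^{ye^t-y}\bigl(Ei(1,ye^t)e^{ye^t}(ye^t-1)-ye^t\bigr)\,dt\\&+y(1-y)\int_0^x(t-x)e^{ye^t}Ei(1,ye^t)\,dt,\end{aligned}$$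 where $\int_0^x$ is taken along the straight segment from $0$ to $x$. Then for all $x,y\in\mathbb C$ such that $\operatorname{Re}(ye^{sx})>0$ for every $s\in[0,1]$ (in particular for all real $x$ and all real $y>0$), $T(\cdot,y)$ is analytic at $x$, and, with $T_{xx}=\partial^2T/\partial x^2$ the second partial derivative in the first variable, $$Q(x,y)=\frac1y\int_0^xe^{-ye^{x-t}-t}\int_0^te^{ye^{x-r}+r}\,(e^{r-x}+y)\,T_{xx}(r,ye^{x-r})\,dr\,dt .$$ -/

import Mathlib

namespace VisRGS

/-- `π = π₁ ⋯ πₙ` (indexed from `0`) is a restricted growth sequence: its letters are positive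
integers, the first letter is `1`, and every letter is at most `1` plus the maximum of the
preceding ones. -/
def IsRGS {n : ℕ} (π : Fin n → ℕ) : Prop :=
  (∀ i, 1 ≤ π i) ∧ (∀ h : 0 < n, π ⟨0, h⟩ = 1) ∧
    ∀ (j : Fin n) (h : j.val + 1 < n), π ⟨j.val + 1, h⟩ ≤ 1 + (Finset.Iic j).sup π

theorem IsRGS.le_succ {n : ℕ} {π : Fin n → ℕ} (hπ : IsRGS π) :
    ∀ (m : ℕ) (h : m < n), π ⟨m, h⟩ ≤ m + 1 := by
  intro m
  induction m using Nat.strong_induction_on with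
  | _ m ih =>
    intro h
    rcases m with _ | m
    · exact (hπ.2.1 h).le
    · have h1 : π ⟨m + 1, h⟩ ≤ 1 + (Finset.Iic (⟨m, by omega⟩ : Fin n)).sup π :=
        hπ.2.2 ⟨m, by omega⟩ h
      have h2 : (Finset.Iic (⟨m, by omega⟩ : Fin n)).sup π ≤ m + 1 := by
        apply Finset.sup_le
        intro i hi
        have hi' : i.val ≤ m := by simpa [Fin.le_def] using hi
        have := ih i.val (by omega) i.isLt
        simp only [Fin.eta] at this
        omega
      omega

open Classical in
/-- The finite set `R_{n,k}` of all restricted growth sequences of length `n` with exactly `k`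
different letters. The a priori bound `πᵢ ≤ n` only serves finiteness, see `mem_R`. -/
noncomputable def R (n k : ℕ) : Finset (Fin n → ℕ) :=
  (Fintype.piFinset fun _ : Fin n => Finset.Icc 1 n).filter
    fun π => IsRGS π ∧ (Finset.univ.image π).card = k

theorem mem_R {n k : ℕ} {π : Fin n → ℕ} :
    π ∈ R n k ↔ IsRGS π ∧ (Finset.univ.image π).card = k := by
  classical
  unfold R
  rw [Finset.mem_filter]
  constructor
  · intro h
    refine ⟨h.2.1, ?_⟩
    convert h.2.2
  · intro h
    refine ⟨?_, h.1, ?_⟩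
    · rw [Fintype.mem_piFinset]
      intro i
      rw [Finset.mem_Icc]
      have := h.1.le_succ i.val i.isLt
      simp only [Fin.eta] at this
      exact ⟨h.1.1 i, by omega⟩
    · convert h.2

/-- The number `V_π` of strong visible pairs of `π`: pairs `i < j` such that every letter strictly
between positions `i` and `j` is smaller than both `πᵢ` and `πⱼ`. -/
def V {n : ℕ} (π : Fin n → ℕ) : ℕ :=
  (Finset.univ.filter fun p : Fin n × Fin n =>
    p.1 < p.2 ∧ ∀ l, p.1 < l → l < p.2 → π l < min (π p.1) (π p.2)).card

/-- The expectation `E(V_π | π ∈ R_{n,k})` for uniformly distributed `π` (`0` if `R_{n,k} = ∅`). -/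
noncomputable def meanV (n k : ℕ) : ℂ :=
  (∑ π ∈ R n k, (V π : ℂ)) / ((R n k).card : ℂ)

/-- The general term `yᵏ xⁿ/n! S_{n,k} E(V_π | π ∈ R_{n,k})` of the double series. -/
noncomputable def qTerm (x y : ℂ) (k n : ℕ) : ℂ :=
  y ^ k * (x ^ n / (n.factorial : ℂ) * ((Nat.stirlingSecond n k : ℂ) * meanV n k))

/-- `Q(x,y) = ∑_{k ≥ 1} yᵏ ∑_{n ≥ 0} xⁿ/n! S_{n,k} E(V_π | π ∈ R_{n,k})`. -/
noncomputable def Q (x y : ℂ) : ℂ :=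
  ∑' k : ℕ, ∑' n : ℕ, qTerm x y (k + 1) n

/-- The integral `∫₀ˣ f(t) dt` along the straight segment from `0` to `x`. -/
noncomputable def segInt (x : ℂ) (f : ℂ → ℂ) : ℂ :=
  ∫ s in (0 : ℝ)..1, f ((s : ℂ) * x) * x

/-- The exponential integral `Ei(1,z) = ∫₁^∞ e^{-zt}/t dt` (convergent for `Re z > 0`). -/
noncomputable def Ei1 (z : ℂ) : ℂ :=
  ∫ t in Set.Ioi (1 : ℝ), Complex.exp (-z * (t : ℂ)) / (t : ℂ)

open Complex in
/-- The function `T(x,y)`. -/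
noncomputable def T (x y : ℂ) : ℂ :=
  y ^ 3 * segInt x (fun t => (x - t) * exp (y * exp t - y) *
      segInt t (fun r => Ei1 (y * exp r) * exp (y * exp r + 2 * r)))
  + y * segInt x (fun t => (t - x) * exp (y * exp t - y) *
      (Ei1 (y * exp t) * exp (y * exp t) * (y * exp t - 1) - y * exp t))
  + y * (1 - y) * segInt x (fun t => (t - x) * exp (y * exp t) * Ei1 (y * exp t))

/-- The second partial derivative `∂²T/∂x²` at `(x,y)`. -/
noncomputable def Txx (x y : ℂ) : ℂ :=
  iteratedDeriv 2 (fun s => T s y) x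

/-- The points `(x,y)` such that `Re (y e^{sx}) > 0` for all `s ∈ [0,1]`, so that every exponential
integral in the formulas converges. It contains all `(x,y)` with `x` real and `y > 0`. -/
def Dom (x y : ℂ) : Prop :=
  ∀ s : ℝ, 0 ≤ s → s ≤ 1 → 0 < (y * Complex.exp ((s : ℂ) * x)).re

end VisRGS

/-! Appending a last letter to a restricted growth sequence shows that the numbers `∑ V_π`, and the
convolutions of Stirling numbers that count the positions seen by the new letter, satisfy linear
recurrences. For the generating functions these are differential equations in the single derivation
`∂ₓ - y ∂_y`, whose characteristics are the curves on which `y eˣ` is constant, so that everything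
reduces to linear ordinary differential equations. One array has the generating function `M` with
`(∂ₓ - y ∂_y) M = y M + y D`, `(∂ₓ - y ∂_y) D = -D + y exp (y eˣ - y)`; solving these equations
produces the exponential integral, and `M` turns out to be `T_xx / y`. Finally
`(∂ₓ - y ∂_y)² Q = (y - 1) (∂ₓ - y ∂_y) Q + (1 + y) M`, and integrating this twice along
characteristics gives the formula. -/

namespace VisRGS

section RestrictedGrowth

open Finset

variable {n k : ℕ}

theorem isRGS_iff {π : Fin n → ℕ} :
    IsRGS π ↔ ∀ i, 1 ≤ π i ∧ π i ≤ 1 + (Iio i).sup π := by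
  have Iio_succ : ∀ (m : ℕ) (h : m + 1 < n),
      Iio (⟨m + 1, h⟩ : Fin n) = Iic ⟨m, Nat.lt_of_succ_lt h⟩ := fun m h => by
    ext i
    simp only [mem_Iio, mem_Iic, Fin.lt_def, Fin.le_def, Nat.lt_succ_iff]
  have Iio_zero : ∀ h : 0 < n, Iio (⟨0, h⟩ : Fin n) = ∅ := fun h => by
    ext i
    simp [Fin.lt_def]
  constructor
  · rintro ⟨hpos, hfirst, hgrowth⟩ ⟨_ | m, hi⟩
    · simp [hfirst]
    · exact ⟨hpos _, (Iio_succ m hi).symm ▸ hgrowth ⟨m, Nat.lt_of_succ_lt hi⟩ hi⟩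
  · refine fun h => ⟨fun i => (h i).1, fun h0 => ?_, fun j hj => ?_⟩
    · have := h ⟨0, h0⟩
      rw [Iio_zero, sup_empty, Nat.bot_eq_zero] at this
      omega
    · exact Iio_succ j hj ▸ (h ⟨j + 1, hj⟩).2

theorem isRGS_snoc (π : Fin n → ℕ) (b : ℕ) :
    IsRGS (Fin.snoc π b : Fin (n + 1) → ℕ) ↔ IsRGS π ∧ 1 ≤ b ∧ b ≤ 1 + univ.sup π := by
  have sup_Iio_castSucc (i : Fin n) :
      (Iio i.castSucc).sup (Fin.snoc π b : Fin (n + 1) → ℕ) = (Iio i).sup π := by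
    rw [← Fin.map_castSuccEmb_Iio, sup_map]
    exact sup_congr rfl fun j _ => Fin.snoc_castSucc (α := fun _ => ℕ) b π j
  have sup_Iio_last :
      (Iio (Fin.last n)).sup (Fin.snoc π b : Fin (n + 1) → ℕ) = univ.sup π := by
    rw [Fin.Iio_last_eq_map, sup_map]
    exact sup_congr rfl fun j _ => Fin.snoc_castSucc (α := fun _ => ℕ) b π j
  simp only [isRGS_iff, Fin.forall_fin_succ', Fin.snoc_castSucc, Fin.snoc_last,
    sup_Iio_castSucc, sup_Iio_last]

theorem univ_image_snoc {α : Type*} [DecidableEq α] (π : Fin n → α) (b : α) :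
    univ.image (Fin.snoc π b : Fin (n + 1) → α) = insert b (univ.image π) := by
  simp [← coe_inj]

theorem univ_sup_snoc {α : Type*} [SemilatticeSup α] [OrderBot α] (π : Fin n → α) (b : α) :
    univ.sup (Fin.snoc π b : Fin (n + 1) → α) = b ⊔ univ.sup π := by
  rw [Fin.univ_castSuccEmb, sup_cons, sup_map, Fin.snoc_last]
  congr 1
  exact sup_congr rfl fun j _ => Fin.snoc_castSucc (α := fun _ => α) b π j

theorem IsRGS.image_eq {π : Fin n → ℕ} (hπ : IsRGS π) :
    univ.image π = Icc 1 (univ.sup π) := by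
  induction n with
  | zero => simp
  | succ n ih =>
    rw [← Fin.snoc_init_self π] at hπ ⊢
    obtain ⟨hinit, hpos, hle⟩ := (isRGS_snoc _ _).1 hπ
    rw [univ_image_snoc, univ_sup_snoc, ih hinit]
    ext a
    simp only [mem_insert, mem_Icc]
    omega

theorem mem_R_iff_sup {π : Fin n → ℕ} : π ∈ R n k ↔ IsRGS π ∧ univ.sup π = k := by
  rw [mem_R]
  refine and_congr_right fun h => ?_
  rw [h.image_eq, Nat.card_Icc, Nat.add_sub_cancel]

theorem snoc_mem_R {π : Fin n → ℕ} {b : ℕ} :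
    (Fin.snoc π b : Fin (n + 1) → ℕ) ∈ R (n + 1) (k + 1) ↔
      (π ∈ R n (k + 1) ∧ b ∈ Icc 1 (k + 1)) ∨ (π ∈ R n k ∧ b = k + 1) := by
  simp only [mem_R_iff_sup, isRGS_snoc, univ_sup_snoc, mem_Icc]
  by_cases h : IsRGS π <;> simp only [h, true_and, false_and, or_self]
  omega

theorem R_succ_zero (n : ℕ) : R (n + 1) 0 = ∅ := by
  refine eq_empty_of_forall_notMem fun π h => ?_
  obtain ⟨hπ, hsup⟩ := mem_R_iff_sup.1 h
  exact absurd ((hπ.1 0).trans (le_sup (f := π) (mem_univ 0))) (by omega)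

theorem R_zero_succ (k : ℕ) : R 0 (k + 1) = ∅ :=
  eq_empty_of_forall_notMem fun π h => by simpa using (mem_R_iff_sup.1 h).2

theorem R_zero_zero : R 0 0 = univ := by
  ext π
  exact iff_of_true (mem_R_iff_sup.2 ⟨isRGS_iff.2 fun i => i.elim0, by simp⟩) (mem_univ π)

theorem sum_R_succ {M : Type*} [AddCommMonoid M] (n k : ℕ) (g : (Fin (n + 1) → ℕ) → M) :
    ∑ σ ∈ R (n + 1) (k + 1), g σ =
      (∑ π ∈ R n (k + 1), ∑ b ∈ Icc 1 (k + 1), g (Fin.snoc π b)) +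
        ∑ π ∈ R n k, g (Fin.snoc π (k + 1)) := by
  have hdisj : Disjoint (R n (k + 1) ×ˢ Icc 1 (k + 1)) (R n k ×ˢ {k + 1}) := by
    refine disjoint_product.2 (Or.inl (disjoint_left.2 fun π h h' => ?_))
    have := (mem_R_iff_sup.1 h).2.symm.trans (mem_R_iff_sup.1 h').2
    omega
  have hnew : ∑ π ∈ R n k, g (Fin.snoc π (k + 1)) =
      ∑ p ∈ R n k ×ˢ {k + 1}, g (Fin.snoc p.1 p.2) := by
    simp only [sum_product, sum_singleton]
  rw [hnew, ← sum_product' (f := fun π b => g (Fin.snoc π b)), ← sum_union hdisj]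
  symm
  refine sum_nbij' (fun p => (Fin.snoc p.1 p.2 : Fin (n + 1) → ℕ))
    (fun σ => (Fin.init σ, σ (Fin.last n))) (fun p hp => ?_) (fun σ hσ => ?_)
    (fun p _ => by simp) (fun σ _ => by simp) fun _ _ => rfl
  · simpa only [mem_union, mem_product, mem_singleton, snoc_mem_R] using hp
  · rw [← Fin.snoc_init_self σ, snoc_mem_R] at hσ
    simpa only [mem_union, mem_product, mem_singleton] using hσ

theorem card_R (n k : ℕ) : #(R n k) = n.stirlingSecond k := by
  induction n generalizing k with
  | zero => cases k <;> simp [R_zero_zero, R_zero_succ]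
  | succ n ih =>
    cases k with
    | zero => simp [R_succ_zero]
    | succ k =>
      rw [card_eq_sum_ones, sum_R_succ, Nat.stirlingSecond_succ_succ, ← ih, ← ih]
      simp [mul_comm]

end RestrictedGrowth

section StrongVisibility

open Finset

variable {n : ℕ}

/-- The number of positions of `π` that form a strong visible pair with a letter `b` appended at the
end of `π`. -/
def seenBy (π : Fin n → ℕ) (b : ℕ) : ℕ :=
  #{i | ∀ l, i < l → π l < min (π i) b}

/-- The number of positions of `π` that carry the letter `a` and are followed only by letters at
most `m`. -/
def tailCount (π : Fin n → ℕ) (m a : ℕ) : ℕ :=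
  #{i | π i = a ∧ ∀ l, i < l → π l ≤ m}

theorem V_snoc (π : Fin n → ℕ) (b : ℕ) :
    V (Fin.snoc π b : Fin (n + 1) → ℕ) = V π + seenBy π b := by
  have hlast (i : Fin n) : ¬ Fin.last n < i.castSucc := not_lt.2 (Fin.le_last _)
  simp only [V, seenBy, card_filter, Fintype.sum_prod_type_right, Fin.sum_univ_castSucc]
  simp [Fin.forall_fin_succ', Fin.castSucc_lt_last, hlast]

theorem tailCount_snoc (π : Fin n → ℕ) (b m a : ℕ) :
    tailCount (Fin.snoc π b : Fin (n + 1) → ℕ) m a =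
      (if b = a then 1 else 0) + if b ≤ m then tailCount π m a else 0 := by
  have hlast (i : Fin n) : ¬ Fin.last n < i.castSucc := not_lt.2 (Fin.le_last _)
  simp only [tailCount, card_filter, Fin.sum_univ_castSucc]
  by_cases h : b ≤ m <;> simp [Fin.forall_fin_succ', Fin.castSucc_lt_last, h, hlast, add_comm]

theorem seenBy_succ {k : ℕ} {π : Fin n → ℕ} (hπ : π ∈ R n k) (b : ℕ) :
    seenBy π (b + 1) = ∑ a ∈ range k, tailCount π (min a b) (a + 1) := by
  obtain ⟨hrgs, hsup⟩ := mem_R_iff_sup.1 hπ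
  have hletter (i : Fin n) : 1 ≤ π i ∧ π i ≤ k := ⟨hrgs.1 i, hsup ▸ le_sup (mem_univ i)⟩
  rw [seenBy, card_eq_sum_card_fiberwise (f := fun i => π i - 1) (t := range k)]
  · refine sum_congr rfl fun a _ => ?_
    rw [tailCount, filter_filter]
    congr 1 with i
    simp only [mem_filter, mem_univ, true_and]
    rw [and_comm, show π i - 1 = a ↔ π i = a + 1 by have := hletter i; omega]
    refine and_congr_right fun h => forall₂_congr fun l _ => ?_
    omega
  · intro i _
    have := hletter i
    exact mem_coe.2 (mem_range.2 (show π i - 1 < k by omega))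

theorem V_le (π : Fin n → ℕ) : V π ≤ n * n :=
  (card_le_univ _).trans (by simp)

/-- The total number of strong visible pairs over all of `R_{n,k}`. -/
noncomputable def totalV (n k : ℕ) : ℕ := ∑ π ∈ R n k, V π

theorem totalV_le (n k : ℕ) : totalV n k ≤ n * n * n.stirlingSecond k := by
  rw [totalV, ← card_R, mul_comm, ← smul_eq_mul]
  exact sum_le_card_nsmul _ _ _ fun π _ => V_le π

theorem totalV_of_le_one (hn : n ≤ 1) (k : ℕ) : totalV n k = 0 :=
  have := Fin.subsingleton_iff_le_one.2 hn
  sum_eq_zero fun _ _ => card_eq_zero.2 <| filter_eq_empty_iff.2 fun _ _ hp =>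
    hp.1.ne (Subsingleton.elim _ _)

theorem totalV_zero_right (n : ℕ) : totalV n 0 = 0 := by
  cases n with
  | zero => exact totalV_of_le_one zero_le_one 0
  | succ n => simp [totalV, R_succ_zero]

theorem totalV_succ_succ (n k : ℕ) :
    totalV (n + 1) (k + 1) = (k + 1) * totalV n (k + 1) + totalV n k +
      (∑ b ∈ range (k + 1), ∑ π ∈ R n (k + 1), seenBy π (b + 1) +
        ∑ π ∈ R n k, seenBy π (k + 1)) := by
  have hshift (f : ℕ → ℕ) : ∑ b ∈ Icc 1 (k + 1), f b = ∑ b ∈ range (k + 1), f (b + 1) := by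
    rw [range_eq_Ico, sum_Ico_add' f 0 (k + 1) 1]
    rfl
  simp only [totalV, sum_R_succ, V_snoc, sum_add_distrib, sum_const, card_range, smul_eq_mul,
    ← mul_sum, hshift]
  rw [sum_comm (s := range (k + 1))]
  ring

end StrongVisibility

section StirlingConvolution

open Finset Nat

/-- The coefficients of `x D_k(x) / (1 - c x)`, where `D_k(x) = ∑ₙ S_{n,k} xⁿ`. A position after
which only `c` letters are allowed contributes the factor `x / (1 - c x)`. -/
def stirlingConv : ℕ → ℕ → ℕ → ℕ
  | 0, _, _ => 0
  | n + 1, k, c => c * stirlingConv n k c + n.stirlingSecond k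

/-- The sum over all `c < k` of the convolutions `stirlingConv n k c`. -/
def convSum (n k : ℕ) : ℕ := ∑ c ∈ range k, stirlingConv n k c

/-- The sum over all pairs `c, d < k` of the convolutions `stirlingConv n k (min c d)`. -/
def convSumMin (n k : ℕ) : ℕ :=
  ∑ c ∈ range k, ∑ d ∈ range k, stirlingConv n k (min c d)

theorem stirlingConv_succ_succ (n k c : ℕ) :
    stirlingConv (n + 1) (k + 1) c = (k + 1) * stirlingConv n (k + 1) c + stirlingConv n k c := by
  have hrec (m j : ℕ) :
      stirlingConv (m + 1) j c = c * stirlingConv m j c + m.stirlingSecond j := rfl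
  induction n with
  | zero => simp [stirlingConv]
  | succ n ih =>
    rw [hrec] at ih
    rw [hrec, hrec, hrec, stirlingSecond_succ_succ]
    linear_combination c * ih

theorem stirlingConv_self_le (n k : ℕ) : stirlingConv n k k ≤ n.stirlingSecond (k + 1) := by
  induction n with
  | zero => simp [stirlingConv]
  | succ n ih =>
    rw [stirlingConv, stirlingSecond_succ_succ]
    gcongr
    omega

theorem stirlingConv_le {k c : ℕ} (hc : c < k) (n : ℕ) :
    stirlingConv n k c ≤ n * n.stirlingSecond k := by
  obtain ⟨k, rfl⟩ := exists_eq_add_one_of_ne_zero hc.ne_bot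
  induction n with
  | zero => simp [stirlingConv]
  | succ n ih =>
    have hle : (k + 1) * n.stirlingSecond (k + 1) ≤ (n + 1).stirlingSecond (k + 1) := by
      rw [stirlingSecond_succ_succ]
      exact le_self_add
    calc stirlingConv (n + 1) (k + 1) c
        = c * stirlingConv n (k + 1) c + n.stirlingSecond (k + 1) := rfl
      _ ≤ (k + 1) * (n * n.stirlingSecond (k + 1)) + (k + 1) * n.stirlingSecond (k + 1) := by
          gcongr
          exact Nat.le_mul_of_pos_left _ k.succ_pos
      _ = (n + 1) * ((k + 1) * n.stirlingSecond (k + 1)) := by ring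
      _ ≤ (n + 1) * (n + 1).stirlingSecond (k + 1) := by gcongr

theorem convSum_le (n k : ℕ) : convSum n k ≤ k * n * n.stirlingSecond k :=
  (sum_le_card_nsmul _ _ _ fun _ hc => stirlingConv_le (mem_range.1 hc) n).trans_eq
    (by simp [mul_assoc])

theorem convSumMin_le (n k : ℕ) : convSumMin n k ≤ k * k * n * n.stirlingSecond k :=
  (sum_le_card_nsmul _ _ _ fun _ hc => sum_le_card_nsmul _ _ _ fun _ _ =>
    stirlingConv_le ((min_le_left _ _).trans_lt (mem_range.1 hc)) n).trans_eq (by simp [mul_assoc])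

theorem convSum_succ_succ (n k : ℕ) :
    convSum (n + 1) (k + 1) = (k + 1) * convSum n (k + 1) + convSum n k + stirlingConv n k k := by
  simp only [convSum, stirlingConv_succ_succ, sum_add_distrib, ← mul_sum]
  rw [sum_range_succ (fun c => stirlingConv n k c) k]
  ring

theorem sum_min_range_succ {M : Type*} [AddCommMonoid M] (k : ℕ) (f : ℕ → M) :
    ∑ c ∈ range (k + 1), ∑ d ∈ range (k + 1), f (min c d) =
      ∑ c ∈ range k, ∑ d ∈ range k, f (min c d) + 2 • ∑ c ∈ range k, f c + f k := by
  have hleft : ∑ c ∈ range k, f (min c k) = ∑ c ∈ range k, f c :=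
    sum_congr rfl fun c hc => by rw [min_eq_left (mem_range.1 hc).le]
  have hright : ∑ d ∈ range k, f (min k d) = ∑ d ∈ range k, f d :=
    sum_congr rfl fun d hd => by rw [min_eq_right (mem_range.1 hd).le]
  simp only [sum_range_succ, sum_add_distrib, hleft, hright, min_self]
  abel

theorem convSumMin_succ_succ (n k : ℕ) :
    convSumMin (n + 1) (k + 1) =
      (k + 1) * convSumMin n (k + 1) + convSumMin n k + 2 * convSum n k + stirlingConv n k k := by
  simp only [convSumMin, stirlingConv_succ_succ, sum_add_distrib, ← mul_sum]
  rw [sum_min_range_succ k (stirlingConv n k), convSum]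
  ring

theorem sum_tailCount {k m a : ℕ} (hm : m ≤ k) (ha : a ∈ Icc 1 (k + 1)) (n : ℕ) :
    ∑ π ∈ R n (k + 1), tailCount π m a =
      stirlingConv n (k + 1) m + if a = k + 1 then stirlingConv n k m else 0 := by
  induction n with
  | zero => simp [R_zero_succ, stirlingConv]
  | succ n ih =>
    have hfilter : #{b ∈ Icc 1 (k + 1) | b ≤ m} = m := by
      rw [show {b ∈ Icc 1 (k + 1) | b ≤ m} = Icc 1 m by ext; simp; omega]
      simp
    have hold (π : Fin n → ℕ) : ∑ b ∈ Icc 1 (k + 1),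
        tailCount (Fin.snoc π b : Fin (n + 1) → ℕ) m a = 1 + m * tailCount π m a := by
      simp only [tailCount_snoc, sum_add_distrib]
      rw [sum_ite_eq', if_pos ha, ← sum_filter, sum_const, hfilter, smul_eq_mul]
    have hnew (π : Fin n → ℕ) : tailCount (Fin.snoc π (k + 1) : Fin (n + 1) → ℕ) m a =
        if a = k + 1 then 1 else 0 := by
      rw [tailCount_snoc, if_neg (show ¬ k + 1 ≤ m by omega), add_zero]
      simp only [eq_comm]
    rw [sum_R_succ]
    simp only [hold, hnew, sum_add_distrib, ← mul_sum, ih, sum_const, card_R, smul_eq_mul,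
      stirlingConv]
    split_ifs <;> ring

theorem sum_seenBy {k b : ℕ} (hb : b ≤ k + 1) (n : ℕ) :
    ∑ π ∈ R n (k + 1), seenBy π (b + 1) =
      ∑ a ∈ range (k + 1), stirlingConv n (k + 1) (min a b) + stirlingConv n k (min k b) := by
  rw [sum_congr rfl fun π hπ => seenBy_succ hπ b, sum_comm]
  have htail (a : ℕ) (ha : a ∈ range (k + 1)) :
      ∑ π ∈ R n (k + 1), tailCount π (min a b) (a + 1) = stirlingConv n (k + 1) (min a b) +
        if a + 1 = k + 1 then stirlingConv n k (min a b) else 0 := by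
    have ha' := mem_range.1 ha
    exact sum_tailCount (by omega) (mem_Icc.2 ⟨by omega, by omega⟩) n
  simp only [sum_congr rfl htail, sum_add_distrib, Nat.add_right_cancel_iff, sum_ite_eq']
  simp

theorem sum_sum_seenBy (n k : ℕ) :
    ∑ b ∈ range (k + 1), ∑ π ∈ R n (k + 1), seenBy π (b + 1) =
      convSumMin n (k + 1) + convSum n k + stirlingConv n k k := by
  have hmin : ∑ b ∈ range (k + 1), stirlingConv n k (min k b) =
      convSum n k + stirlingConv n k k := by
    rw [convSum, ← sum_range_succ]
    exact sum_congr rfl fun b hb => by rw [min_eq_right (mem_range_succ_iff.1 hb)]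
  rw [sum_congr rfl fun b hb => sum_seenBy (mem_range.1 hb).le n, sum_add_distrib, hmin, sum_comm,
    add_assoc]
  rfl

theorem sum_seenBy_succ_self (n k : ℕ) :
    ∑ π ∈ R n (k + 1), seenBy π (k + 2) = convSum n (k + 1) + stirlingConv n k k := by
  rw [sum_seenBy le_rfl, min_eq_left k.le_succ, convSum]
  congr 1
  exact sum_congr rfl fun a ha => by rw [min_eq_left (mem_range.1 ha).le]

end StirlingConvolution

section ExponentialGeneratingFunctions

open scoped Nat

variable {f g : ℕ → ℕ → ℂ} {x y : ℂ}

/-- The term of index `p = (k, n)` of the generating function `∑ f n k yᵏ xⁿ / n!` of the array `f`,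
which is exponential in `x` and ordinary in `y`. -/
noncomputable def egfTerm (f : ℕ → ℕ → ℂ) (x y : ℂ) (p : ℕ × ℕ) : ℂ :=
  y ^ p.1 * (x ^ p.2 / p.2 ! * f p.2 p.1)

/-- The sum `∑ f n k yᵏ xⁿ / n!` of the generating function of the array `f`. -/
noncomputable def egf (f : ℕ → ℕ → ℂ) (x y : ℂ) : ℂ := ∑' p, egfTerm f x y p

theorem egfTerm_add (f g : ℕ → ℕ → ℂ) (x y : ℂ) :
    egfTerm (f + g) x y = egfTerm f x y + egfTerm g x y := by
  ext p
  simp only [egfTerm, Pi.add_apply]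
  ring

theorem egfTerm_smul (c : ℂ) (f : ℕ → ℕ → ℂ) (x y : ℂ) :
    egfTerm (c • f) x y = c • egfTerm f x y := by
  ext p
  simp only [egfTerm, Pi.smul_apply, smul_eq_mul]
  ring

/-- The space of all arrays whose generating function converges absolutely everywhere. -/
def entireEGF : Submodule ℂ (ℕ → ℕ → ℂ) where
  carrier := {f | ∀ x y, Summable (egfTerm f x y)}
  zero_mem' x y := summable_zero.congr fun p => by simp [egfTerm]
  add_mem' hf hg x y := egfTerm_add _ _ x y ▸ (hf x y).add (hg x y)
  smul_mem' c _ hf x y := egfTerm_smul c _ x y ▸ (hf x y).const_smul c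

theorem egf_add (hf : f ∈ entireEGF) (hg : g ∈ entireEGF) (x y : ℂ) :
    egf (f + g) x y = egf f x y + egf g x y := by
  rw [egf, egfTerm_add]
  exact (hf x y).tsum_add (hg x y)

theorem egf_smul (c : ℂ) (f : ℕ → ℕ → ℂ) (x y : ℂ) : egf (c • f) x y = c * egf f x y := by
  rw [egf, egfTerm_smul]
  exact tsum_mul_left

theorem egf_sub (hf : f ∈ entireEGF) (hg : g ∈ entireEGF) (x y : ℂ) :
    egf (f - g) x y = egf f x y - egf g x y := by
  rw [sub_eq_add_neg, ← neg_one_smul ℂ g, egf_add hf (entireEGF.smul_mem _ hg), egf_smul]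
  ring

theorem egf_zero_left (hf : ∀ k, f 0 k = 0) (y : ℂ) : egf f 0 y = 0 := by
  refine (tsum_congr fun p => ?_).trans tsum_zero
  obtain ⟨k, _ | n⟩ := p <;> simp [egfTerm, hf]

theorem norm_egfTerm (f : ℕ → ℕ → ℂ) (x y : ℂ) (p : ℕ × ℕ) :
    ‖egfTerm f x y p‖ = ‖y‖ ^ p.1 * (‖x‖ ^ p.2 / p.2 ! * ‖f p.2 p.1‖) := by
  simp only [egfTerm, norm_mul, norm_div, norm_pow, Complex.norm_natCast]

theorem mem_entireEGF_of_norm_le (C : ℝ) (hg : g ∈ entireEGF)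
    (hfg : ∀ n k, ‖f n k‖ ≤ C ^ (n + k) * ‖g n k‖) : f ∈ entireEGF := by
  refine fun x y => .of_norm_bounded (hg (C * x) (C * y)).norm fun ⟨k, n⟩ => ?_
  have hpow : C ^ (n + k) ≤ |C| ^ (n + k) := (le_abs_self _).trans_eq (abs_pow C _)
  simp only [norm_egfTerm, norm_mul, Complex.norm_real, Real.norm_eq_abs, mul_pow]
  calc ‖y‖ ^ k * (‖x‖ ^ n / n ! * ‖f n k‖)
      ≤ ‖y‖ ^ k * (‖x‖ ^ n / n ! * (|C| ^ (n + k) * ‖g n k‖)) := by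
        gcongr
        exact (hfg n k).trans (mul_le_mul_of_nonneg_right hpow (norm_nonneg _))
    _ = |C| ^ k * ‖y‖ ^ k * (|C| ^ n * ‖x‖ ^ n / n ! * ‖g n k‖) := by ring

/-- The operator on arrays that corresponds to multiplication of the generating function by `y`. -/
def mulY : (ℕ → ℕ → ℂ) →ₗ[ℂ] ℕ → ℕ → ℂ where
  toFun f n k := k.casesOn 0 (f n)
  map_add' f g := by ext n (_ | k) <;> simp
  map_smul' c f := by ext n (_ | k) <;> simp

/-- The operator on arrays that corresponds to the derivation `∂/∂x`. -/
def derivX : (ℕ → ℕ → ℂ) →ₗ[ℂ] ℕ → ℕ → ℂ where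
  toFun f n k := f (n + 1) k
  map_add' _ _ := rfl
  map_smul' _ _ := rfl

/-- The operator on arrays that corresponds to the derivation `y ∂/∂y`. -/
def eulerY : (ℕ → ℕ → ℂ) →ₗ[ℂ] ℕ → ℕ → ℂ where
  toFun f n k := k * f n k
  map_add' f g := by ext; simp [mul_add]
  map_smul' c f := by ext; simp [mul_left_comm]

/-- The operator on arrays that corresponds to the derivation `∂/∂x - y ∂/∂y`, whose characteristics
are the curves on which `y eˣ` is constant. -/
def charDeriv : (ℕ → ℕ → ℂ) →ₗ[ℂ] ℕ → ℕ → ℂ := derivX - eulerY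

theorem mulY_zero (f : ℕ → ℕ → ℂ) (n : ℕ) : mulY f n 0 = 0 := rfl

theorem mulY_succ (f : ℕ → ℕ → ℂ) (n k : ℕ) : mulY f n (k + 1) = f n k := rfl

theorem charDeriv_apply (f : ℕ → ℕ → ℂ) (n k : ℕ) :
    charDeriv f n k = f (n + 1) k - k * f n k := rfl

theorem charDeriv_mulY (f : ℕ → ℕ → ℂ) : charDeriv (mulY f) = mulY (charDeriv f) - mulY f := by
  ext n (_ | k)
  · simp [charDeriv_apply, mulY_zero]
  · simp only [charDeriv_apply, mulY_succ, Pi.sub_apply, Nat.cast_succ]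
    ring

theorem hasSum_egfTerm_mulY {a : ℂ} (h : HasSum (egfTerm f x y) a) :
    HasSum (egfTerm (mulY f) x y) (y * a) := by
  have hinj : Function.Injective (Prod.map Nat.succ id : ℕ × ℕ → ℕ × ℕ) :=
    Nat.succ_injective.prodMap Function.injective_id
  refine (hinj.hasSum_iff ?_).1 ((h.mul_left y).congr_fun fun p => ?_)
  · rintro ⟨_ | k, n⟩ hp
    · simp [egfTerm, mulY_zero]
    · exact absurd ⟨(k, n), rfl⟩ hp
  · simp only [egfTerm, Function.comp_apply, Prod.map_fst, Prod.map_snd, Nat.succ_eq_add_one,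
      mulY_succ, id, pow_succ]
    ring

theorem mulY_mem (hf : f ∈ entireEGF) : mulY f ∈ entireEGF :=
  fun x y => (hasSum_egfTerm_mulY (hf x y).hasSum).summable

theorem egf_mulY (hf : f ∈ entireEGF) (x y : ℂ) : egf (mulY f) x y = y * egf f x y :=
  (hasSum_egfTerm_mulY (hf x y).hasSum).tsum_eq

theorem eulerY_mem (hf : f ∈ entireEGF) : eulerY f ∈ entireEGF := by
  refine mem_entireEGF_of_norm_le 2 hf fun n k => ?_
  have hk : (k : ℝ) ≤ 2 ^ (n + k) := by
    exact_mod_cast Nat.lt_two_pow_self.le.trans (Nat.pow_le_pow_right two_pos (k.le_add_left n))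
  calc ‖eulerY f n k‖ = k * ‖f n k‖ := by
        rw [← Complex.norm_natCast, ← norm_mul]
        rfl
    _ ≤ 2 ^ (n + k) * ‖f n k‖ := by gcongr

theorem derivX_mem (hf : f ∈ entireEGF) : derivX f ∈ entireEGF := by
  intro x y
  have hinj : Function.Injective (Prod.map id Nat.succ : ℕ × ℕ → ℕ × ℕ) :=
    Function.injective_id.prodMap Nat.succ_injective
  refine .of_norm_bounded ((hf (2 * (‖x‖ + 1) : ℝ) y).norm.comp_injective hinj) fun ⟨k, n⟩ => ?_
  have hx : (n + 1 : ℝ) * ‖x‖ ^ n ≤ (2 * (‖x‖ + 1)) ^ (n + 1) := by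
    rw [mul_pow]
    gcongr
    · exact_mod_cast Nat.lt_two_pow_self.le
    · calc ‖x‖ ^ n ≤ (‖x‖ + 1) ^ n := by gcongr; linarith
        _ ≤ (‖x‖ + 1) ^ (n + 1) :=
          pow_le_pow_right₀ (by linarith [norm_nonneg x]) n.le_succ
  have hfact : ‖x‖ ^ n / n ! = (n + 1) * ‖x‖ ^ n / (n + 1)! := by
    rw [Nat.factorial_succ]
    push_cast
    field_simp
  simp only [Function.comp_apply, norm_egfTerm, Prod.map_fst, Prod.map_snd, id,
    Nat.succ_eq_add_one, Complex.norm_real, Real.norm_eq_abs,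
    abs_of_nonneg (show 0 ≤ 2 * (‖x‖ + 1) by positivity), hfact]
  change _ * (_ * ‖f (n + 1) k‖) ≤ _
  gcongr

theorem charDeriv_mem (hf : f ∈ entireEGF) : charDeriv f ∈ entireEGF :=
  sub_mem (derivX_mem hf) (eulerY_mem hf)

theorem hasDerivAt_mul_exp_sub (x y z : ℂ) :
    HasDerivAt (fun z => y * Complex.exp (x - z)) (-(y * Complex.exp (x - z))) z := by
  refine (((hasDerivAt_id z).const_sub x).cexp.const_mul y).congr_deriv ?_
  rw [id, mul_neg_one, mul_neg]

theorem hasDerivAt_egfTerm_char (f : ℕ → ℕ → ℂ) (x y : ℂ) (p : ℕ × ℕ) (z : ℂ) :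
    HasDerivAt (fun z => egfTerm f z (y * Complex.exp (x - z)) p)
      ((y * Complex.exp (x - z)) ^ p.1 * (p.2 * z ^ (p.2 - 1) / p.2 ! * f p.2 p.1) -
        egfTerm (eulerY f) z (y * Complex.exp (x - z)) p) z := by
  obtain ⟨k, n⟩ := p
  refine (((hasDerivAt_mul_exp_sub x y z).fun_pow k).mul
    (((hasDerivAt_pow n z).div_const (n ! : ℂ)).mul_const (f n k))).congr_deriv ?_
  have hpow : (k : ℂ) * (y * Complex.exp (x - z)) ^ (k - 1) * (y * Complex.exp (x - z)) =
      k * (y * Complex.exp (x - z)) ^ k := by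
    cases k with
    | zero => simp
    | succ k => rw [Nat.add_sub_cancel, pow_succ, mul_assoc]
  change _ = _ - _ * (_ * (k * f n k))
  linear_combination -(z ^ n / n ! * f n k) * hpow

theorem hasSum_egfTerm_derivX (hf : f ∈ entireEGF) (x y : ℂ) :
    HasSum (fun p : ℕ × ℕ => y ^ p.1 * (p.2 * x ^ (p.2 - 1) / p.2 ! * f p.2 p.1))
      (egf (derivX f) x y) := by
  have hinj : Function.Injective (Prod.map id Nat.succ : ℕ × ℕ → ℕ × ℕ) :=
    Function.injective_id.prodMap Nat.succ_injective
  refine (hinj.hasSum_iff ?_).1 ((derivX_mem hf x y).hasSum.congr_fun fun p => ?_)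
  · rintro ⟨k, _ | n⟩ hp
    · simp
    · exact absurd ⟨(k, n), rfl⟩ hp
  · obtain ⟨k, n⟩ := p
    have hfact : ((n + 1)! : ℂ) = (n + 1) * n ! := by
      rw [Nat.factorial_succ]
      push_cast
      rfl
    have hn : (n + 1 : ℂ) ≠ 0 := n.cast_add_one_ne_zero
    simp only [egfTerm, Function.comp_apply, Prod.map_fst, Prod.map_snd, id, Nat.succ_eq_add_one,
      Nat.add_sub_cancel, Nat.cast_succ, hfact, show derivX f n k = f (n + 1) k from rfl,
      mul_div_mul_left _ _ hn]

theorem hasDerivAt_egf_char (hf : f ∈ entireEGF) (x y z : ℂ) :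
    HasDerivAt (fun z => egf f z (y * Complex.exp (x - z)))
      (egf (charDeriv f) z (y * Complex.exp (x - z))) z := by
  set U : Set ℂ := Metric.ball 0 (‖z‖ + 1)
  have hzU : z ∈ U := by simp [U]
  have hdiff (p : ℕ × ℕ) :
      DifferentiableOn ℂ (fun z => egfTerm f z (y * Complex.exp (x - z)) p) U := fun w _ =>
    (hasDerivAt_egfTerm_char f x y p w).differentiableAt.differentiableWithinAt
  have hbound (p : ℕ × ℕ) (w : ℂ) (hw : w ∈ U) : ‖egfTerm f w (y * Complex.exp (x - w)) p‖ ≤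
      ‖egfTerm f (‖z‖ + 1 : ℝ) (‖y‖ * Real.exp (‖x‖ + (‖z‖ + 1)) : ℝ) p‖ := by
    have hw' : ‖w‖ ≤ ‖z‖ + 1 := (mem_ball_zero_iff.1 hw).le
    have hexp : ‖y * Complex.exp (x - w)‖ ≤ ‖y‖ * Real.exp (‖x‖ + (‖z‖ + 1)) := by
      rw [norm_mul, Complex.norm_exp]
      gcongr
      exact (Complex.re_le_norm _).trans ((norm_sub_le _ _).trans (by gcongr))
    rw [norm_egfTerm, norm_egfTerm, Complex.norm_of_nonneg (by positivity),
      Complex.norm_of_nonneg (by positivity)]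
    gcongr
  have hsum := (hf (‖z‖ + 1 : ℝ) (‖y‖ * Real.exp (‖x‖ + (‖z‖ + 1)) : ℝ)).norm
  have hasSum_deriv := Complex.hasSum_deriv_of_summable_norm hsum hdiff Metric.isOpen_ball
    hbound hzU
  have hdiffAt : DifferentiableAt ℂ (fun z => egf f z (y * Complex.exp (x - z))) z :=
    (Complex.differentiableOn_tsum_of_summable_norm hsum hdiff Metric.isOpen_ball
      hbound).differentiableAt (Metric.isOpen_ball.mem_nhds hzU)
  simp only [(hasDerivAt_egfTerm_char f x y _ z).deriv] at hasSum_deriv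
  refine hdiffAt.hasDerivAt.congr_deriv (hasSum_deriv.unique ?_)
  rw [charDeriv, LinearMap.sub_apply, egf_sub (derivX_mem hf) (eulerY_mem hf)]
  exact (hasSum_egfTerm_derivX hf z _).sub (eulerY_mem hf z _).hasSum

theorem factorial_mul_stirlingSecond_le (n k : ℕ) : k ! * n.stirlingSecond k ≤ (2 * k) ^ n := by
  induction n generalizing k with
  | zero => cases k <;> simp
  | succ n ih =>
    cases k with
    | zero => simp
    | succ k =>
      calc (k + 1)! * (n + 1).stirlingSecond (k + 1)
          = (k + 1) * ((k + 1)! * n.stirlingSecond (k + 1)) +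
              (k + 1) * (k ! * n.stirlingSecond k) := by
            rw [Nat.stirlingSecond_succ_succ, Nat.factorial_succ]
            ring
        _ ≤ (k + 1) * (2 * (k + 1)) ^ n + (k + 1) * (2 * (k + 1)) ^ n := by
            gcongr
            · exact ih (k + 1)
            · exact (ih k).trans (by gcongr; omega)
        _ = (2 * (k + 1)) ^ (n + 1) := by ring

/-- The Stirling numbers of the second kind as an array of complex numbers. -/
def stirlingCoeff : ℕ → ℕ → ℂ := fun n k => n.stirlingSecond k

theorem stirlingCoeff_mem : stirlingCoeff ∈ entireEGF := by
  intro x y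
  set a : ℝ := ‖y‖ * Real.exp (2 * ‖x‖)
  have hexp (t : ℝ) : HasSum (fun n => t ^ n / n !) (Real.exp t) := by
    rw [Real.exp_eq_exp_ℝ]
    exact NormedSpace.expSeries_div_hasSum_exp t
  have hrow (k : ℕ) :
      HasSum (fun n => ‖y‖ ^ k / k ! * ((2 * k * ‖x‖) ^ n / n !)) (a ^ k / k !) := by
    have hexp_pow : Real.exp (2 * k * ‖x‖) = Real.exp (2 * ‖x‖) ^ k := by
      rw [← Real.exp_nat_mul]
      ring_nf
    have hrow_sum : a ^ k / k ! = ‖y‖ ^ k / k ! * Real.exp (2 * k * ‖x‖) := by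
      rw [hexp_pow, mul_pow]
      ring
    exact hrow_sum ▸ (hexp (2 * k * ‖x‖)).mul_left (‖y‖ ^ k / k !)
  have hsum : Summable fun p : ℕ × ℕ => ‖y‖ ^ p.1 / p.1 ! * ((2 * p.1 * ‖x‖) ^ p.2 / p.2 !) := by
    refine (summable_prod_of_nonneg fun p => by positivity).2 ⟨fun k => (hrow k).summable, ?_⟩
    simp only [(hrow _).tsum_eq]
    exact (hexp a).summable
  refine .of_norm_bounded hsum fun ⟨k, n⟩ => ?_
  have hle : (n.stirlingSecond k : ℝ) ≤ (2 * k) ^ n / k ! := by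
    rw [le_div_iff₀' (by positivity)]
    exact_mod_cast factorial_mul_stirlingSecond_le n k
  calc ‖egfTerm stirlingCoeff x y (k, n)‖ = ‖y‖ ^ k * (‖x‖ ^ n / n ! * n.stirlingSecond k) := by
        rw [norm_egfTerm, stirlingCoeff, Complex.norm_natCast]
    _ ≤ ‖y‖ ^ k * (‖x‖ ^ n / n ! * ((2 * k) ^ n / k !)) := by gcongr
    _ = ‖y‖ ^ k / k ! * ((2 * k * ‖x‖) ^ n / n !) := by ring

theorem natCast_mem_entireEGF {u : ℕ → ℕ → ℕ} (d : ℕ)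
    (hu : ∀ n k, u n k ≤ (n + k) ^ d * n.stirlingSecond k) :
    (fun n k => (u n k : ℂ)) ∈ entireEGF := by
  refine mem_entireEGF_of_norm_le (2 ^ d) stirlingCoeff_mem fun n k => ?_
  rw [stirlingCoeff, Complex.norm_natCast, Complex.norm_natCast, ← pow_mul, mul_comm d, pow_mul]
  exact_mod_cast (hu n k).trans (by gcongr; exact Nat.lt_two_pow_self.le)

end ExponentialGeneratingFunctions

section Coefficients

/-- The coefficients `stirlingConv n k k` of `yᵏ⁺¹ xⁿ / n!`. -/
def diagCoeff : ℕ → ℕ → ℂ := mulY fun n k => stirlingConv n k k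

/-- The numbers `convSum n k` as an array of complex numbers. -/
def convCoeff : ℕ → ℕ → ℂ := fun n k => convSum n k

/-- The numbers `convSumMin n k` as an array of complex numbers. -/
def convMinCoeff : ℕ → ℕ → ℂ := fun n k => convSumMin n k

/-- The numbers `totalV n k`, which are the coefficients of `Q`, as an array of complex numbers. -/
noncomputable def totalCoeff : ℕ → ℕ → ℂ := fun n k => totalV n k

/-- The coefficients of the entire function that agrees with `T_xx(x, y) / y` on the domain
of `T`. -/
def txxCoeff : ℕ → ℕ → ℂ :=
  convMinCoeff + (2 : ℂ) • mulY convCoeff + diagCoeff + mulY stirlingCoeff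

theorem diagCoeff_mem : diagCoeff ∈ entireEGF := by
  refine mem_entireEGF_of_norm_le 1 stirlingCoeff_mem fun n k => ?_
  rw [one_pow, one_mul]
  cases k with
  | zero => simp [diagCoeff, mulY_zero]
  | succ k =>
    rw [diagCoeff, mulY_succ, stirlingCoeff, Complex.norm_natCast, Complex.norm_natCast]
    exact_mod_cast stirlingConv_self_le n k

theorem convCoeff_mem : convCoeff ∈ entireEGF :=
  natCast_mem_entireEGF 2 fun n k => (convSum_le n k).trans <|
    Nat.mul_le_mul_right _ (by nlinarith [Nat.zero_le (n * n), Nat.zero_le (k * k)])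

theorem convMinCoeff_mem : convMinCoeff ∈ entireEGF :=
  natCast_mem_entireEGF 3 fun n k => (convSumMin_le n k).trans <| Nat.mul_le_mul_right _ <|
    calc k * k * n ≤ (n + k) * (n + k) * (n + k) := by gcongr <;> omega
      _ = (n + k) ^ 3 := by ring

theorem totalCoeff_mem : totalCoeff ∈ entireEGF :=
  natCast_mem_entireEGF 2 fun n k => (totalV_le n k).trans <|
    Nat.mul_le_mul_right _ (by rw [← sq]; gcongr; omega)

theorem txxCoeff_mem : txxCoeff ∈ entireEGF :=
  add_mem (add_mem (add_mem convMinCoeff_mem (entireEGF.smul_mem 2 (mulY_mem convCoeff_mem)))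
    diagCoeff_mem) (mulY_mem stirlingCoeff_mem)

theorem charDeriv_stirlingCoeff : charDeriv stirlingCoeff = mulY stirlingCoeff := by
  ext n (_ | k)
  · simp [charDeriv_apply, mulY_zero, stirlingCoeff]
  · simp [charDeriv_apply, mulY_succ, stirlingCoeff, Nat.stirlingSecond_succ_succ]

theorem charDeriv_diagCoeff : charDeriv diagCoeff = -diagCoeff + mulY stirlingCoeff := by
  ext n (_ | k)
  · simp [charDeriv_apply, mulY_zero, diagCoeff]
  · simp only [charDeriv_apply, diagCoeff, mulY_succ, stirlingConv, stirlingCoeff, Pi.add_apply,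
      Pi.neg_apply]
    push_cast
    ring

theorem charDeriv_convCoeff : charDeriv convCoeff = mulY convCoeff + diagCoeff := by
  ext n (_ | k)
  · simp [charDeriv_apply, mulY_zero, diagCoeff, convCoeff, convSum]
  · simp only [charDeriv_apply, diagCoeff, mulY_succ, convCoeff, convSum_succ_succ, Pi.add_apply]
    push_cast
    ring

theorem charDeriv_convMinCoeff :
    charDeriv convMinCoeff = mulY convMinCoeff + (2 : ℂ) • mulY convCoeff + diagCoeff := by
  ext n (_ | k)
  · simp [charDeriv_apply, mulY_zero, diagCoeff, convMinCoeff, convSumMin]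
  · simp only [charDeriv_apply, diagCoeff, mulY_succ, convCoeff, convMinCoeff,
      convSumMin_succ_succ, Pi.add_apply, Pi.smul_apply, smul_eq_mul]
    push_cast
    ring

theorem charDeriv_totalCoeff :
    charDeriv totalCoeff = mulY totalCoeff +
      (convMinCoeff + (2 : ℂ) • mulY convCoeff + diagCoeff + mulY diagCoeff) := by
  have hnew (n k : ℕ) :
      (∑ π ∈ R n k, seenBy π (k + 1) : ℕ) = convCoeff n k + diagCoeff n k := by
    cases k with
    | zero =>
      cases n <;> simp [R_zero_zero, R_succ_zero, seenBy, convCoeff, convSum, diagCoeff, mulY_zero]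
    | succ k =>
      rw [sum_seenBy_succ_self, convCoeff, diagCoeff, mulY_succ, Nat.cast_add]
  ext n (_ | k)
  · simp [charDeriv_apply, mulY_zero, diagCoeff, totalCoeff, totalV_zero_right, convMinCoeff,
      convSumMin]
  · simp only [charDeriv_apply, totalCoeff, totalV_succ_succ, sum_sum_seenBy, mulY_succ,
      Nat.cast_add, Nat.cast_mul, hnew, Pi.add_apply, Pi.smul_apply, smul_eq_mul]
    simp only [convMinCoeff, convCoeff, diagCoeff, mulY_succ]
    push_cast
    ring

theorem charDeriv_txxCoeff : charDeriv txxCoeff = mulY txxCoeff + mulY diagCoeff := by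
  simp only [txxCoeff, map_add, map_smul, charDeriv_mulY, charDeriv_stirlingCoeff,
    charDeriv_diagCoeff, charDeriv_convCoeff, charDeriv_convMinCoeff]
  module

theorem charDeriv_charDeriv_totalCoeff :
    charDeriv (charDeriv totalCoeff) =
      mulY (charDeriv totalCoeff) - charDeriv totalCoeff + (txxCoeff + mulY txxCoeff) := by
  have hsource : charDeriv totalCoeff =
      mulY totalCoeff + (txxCoeff - mulY stirlingCoeff + mulY diagCoeff) := by
    rw [charDeriv_totalCoeff, txxCoeff]
    module
  calc charDeriv (charDeriv totalCoeff)
      = mulY (charDeriv totalCoeff) - mulY totalCoeff +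
          (mulY txxCoeff - mulY diagCoeff + mulY stirlingCoeff) := by
        rw [congrArg charDeriv hsource]
        simp only [map_add, map_sub, map_neg, charDeriv_txxCoeff, charDeriv_mulY,
          charDeriv_stirlingCoeff, charDeriv_diagCoeff]
        module
    _ = mulY (charDeriv totalCoeff) - charDeriv totalCoeff + (txxCoeff + mulY txxCoeff) := by
        rw [hsource]
        module

theorem qTerm_eq (x y : ℂ) (k n : ℕ) : qTerm x y k n = egfTerm totalCoeff x y (k, n) := by
  have hmean : (n.stirlingSecond k : ℂ) * meanV n k = totalV n k := by
    rw [meanV, ← card_R, totalV, Nat.cast_sum]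
    refine mul_div_cancel_of_imp' fun h => ?_
    rw [Finset.card_eq_zero.1 (Nat.cast_eq_zero.1 h), Finset.sum_empty]
  rw [qTerm, egfTerm, totalCoeff, hmean]

theorem summable_qTerm (x y : ℂ) : Summable fun p : ℕ × ℕ => qTerm x y (p.1 + 1) p.2 := by
  simp only [qTerm_eq]
  exact (totalCoeff_mem x y).comp_injective (Nat.succ_injective.prodMap Function.injective_id)

theorem Q_eq_egf (x y : ℂ) : Q x y = egf totalCoeff x y := by
  rw [Q, ← (summable_qTerm x y).tsum_prod, egf]
  simp only [qTerm_eq]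
  refine (Nat.succ_injective.prodMap Function.injective_id).tsum_eq ?_
  rintro ⟨_ | k, n⟩ hp
  · simp [egfTerm, totalCoeff, totalV_zero_right] at hp
  · exact ⟨(k, n), rfl⟩

end Coefficients

section SegmentIntegral

open Set

variable {x : ℂ} {f g F : ℂ → ℂ}

theorem mem_segment_zero {z : ℂ} : z ∈ segment ℝ 0 x ↔ ∃ s ∈ Icc (0 : ℝ) 1, (s : ℂ) * x = z := by
  simp [segment_eq_image]

theorem ofReal_mul_mem_segment {s : ℝ} (hs : s ∈ uIcc 0 1) : (s : ℂ) * x ∈ segment ℝ 0 x :=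
  mem_segment_zero.2 ⟨s, uIcc_of_le (zero_le_one' ℝ) ▸ hs, rfl⟩

theorem segInt_congr (h : EqOn f g (segment ℝ 0 x)) : segInt x f = segInt x g :=
  intervalIntegral.integral_congr fun _ hs => by simp only [h (ofReal_mul_mem_segment hs)]

theorem segInt_const_mul (c : ℂ) (f : ℂ → ℂ) : segInt x (fun t => c * f t) = c * segInt x f := by
  simp only [segInt, mul_assoc, intervalIntegral.integral_const_mul]

theorem intervalIntegrable_segment (hf : ContinuousOn f (segment ℝ 0 x)) :
    IntervalIntegrable (fun s : ℝ => f (s * x) * x) MeasureTheory.volume 0 1 := by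
  have hline : ContinuousOn (fun s : ℝ => (s : ℂ) * x) (uIcc 0 1) := by fun_prop
  exact ((hf.comp hline fun _ => ofReal_mul_mem_segment).mul continuousOn_const).intervalIntegrable

theorem segInt_add (hf : ContinuousOn f (segment ℝ 0 x)) (hg : ContinuousOn g (segment ℝ 0 x)) :
    segInt x (fun t => f t + g t) = segInt x f + segInt x g := by
  simp only [segInt, add_mul]
  exact intervalIntegral.integral_add (intervalIntegrable_segment hf)
    (intervalIntegrable_segment hg)

theorem segInt_eq_sub (hF : ∀ z ∈ segment ℝ 0 x, HasDerivAt F (f z) z)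
    (hf : ContinuousOn f (segment ℝ 0 x)) : segInt x f = F x - F 0 := by
  have hline (s : ℝ) : HasDerivAt (fun s : ℝ => (s : ℂ) * x) x s := by
    simpa using (HasDerivAt.ofReal_comp (hasDerivAt_id s)).mul_const x
  rw [segInt, intervalIntegral.integral_eq_sub_of_hasDerivAt
    (fun s hs => (hF _ (ofReal_mul_mem_segment hs)).comp s (hline s))
    (intervalIntegrable_segment hf)]
  simp

theorem eq_of_hasDerivAt_zero (hF : ∀ z ∈ segment ℝ 0 x, HasDerivAt F 0 z) : F x = F 0 := by
  have h := segInt_eq_sub (f := fun _ => 0) hF continuousOn_const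
  simp only [segInt, zero_mul, intervalIntegral.integral_zero] at h
  exact sub_eq_zero.1 h.symm

variable {C : Set ℂ}

theorem hasDerivAt_segInt (hC : Convex ℝ C) (hCo : IsOpen C) (h0 : (0 : ℂ) ∈ C)
    (hf : DifferentiableOn ℂ f C) {z : ℂ} (hz : z ∈ C) :
    HasDerivAt (fun z => segInt z f) (f z) z := by
  obtain ⟨P, hP⟩ := hC.exists_forall_hasDerivWithinAt hf
  have hP' (w : ℂ) (hw : w ∈ C) : HasDerivAt P (f w) w := (hP w hw).hasDerivAt (hCo.mem_nhds hw)
  have hprim : EqOn (fun z => segInt z f) (fun z => P z - P 0) C := fun w hw =>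
    have hsub := hC.segment_subset h0 hw
    segInt_eq_sub (fun v hv => hP' v (hsub hv)) (hf.continuousOn.mono hsub)
  exact ((hP' z hz).sub_const (P 0)).congr_of_eventuallyEq
    (hprim.eventuallyEq_of_mem (hCo.mem_nhds hz))

theorem segInt_sub_mul (hC : Convex ℝ C) (hCo : IsOpen C) (h0 : (0 : ℂ) ∈ C)
    (hf : DifferentiableOn ℂ f C) {z : ℂ} (hz : z ∈ C) :
    segInt z (fun t => (z - t) * f t) = segInt z (fun t => segInt t f) := by
  have hsub := hC.segment_subset h0 hz
  have hprim (w : ℂ) (hw : w ∈ C) := hasDerivAt_segInt hC hCo h0 hf hw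
  have hP : ContinuousOn (fun t => segInt t f) (segment ℝ 0 z) := fun t ht =>
    (hprim t (hsub ht)).continuousAt.continuousWithinAt
  have hf' := hf.continuousOn.mono hsub
  have hparts := segInt_eq_sub (x := z) (F := fun t => (z - t) * segInt t f)
    (f := fun t => (z - t) * f t + -1 * segInt t f)
    (fun t ht => (((hasDerivAt_id t).const_sub z).mul (hprim t (hsub ht))).congr_deriv
      (by simp only [id]; ring)) (by fun_prop)
  rw [segInt_add (by fun_prop) (by fun_prop), segInt_const_mul] at hparts
  have hzero : segInt 0 f = 0 := by simp [segInt]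
  rw [hzero] at hparts
  linear_combination hparts

end SegmentIntegral

section ExponentialIntegral

open Complex MeasureTheory Set

variable {z : ℂ}

theorem norm_exp_neg_mul_ofReal (z : ℂ) (t : ℝ) : ‖exp (-z * t)‖ = Real.exp (-z.re * t) := by
  simp [norm_exp]

theorem ofReal_ne_zero_of_one_lt {t : ℝ} (ht : t ∈ Ioi 1) : (t : ℂ) ≠ 0 :=
  ofReal_ne_zero.2 (one_pos.trans ht).ne'

theorem continuousOn_exp_neg_mul_div (z : ℂ) :
    ContinuousOn (fun t : ℝ => exp (-z * t) / t) (Ioi 1) :=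
  ContinuousOn.div (by fun_prop) (by fun_prop) fun _ => ofReal_ne_zero_of_one_lt

theorem integrableOn_exp_neg_mul_div (hz : 0 < z.re) :
    IntegrableOn (fun t : ℝ => exp (-z * t) / t) (Ioi 1) := by
  refine Integrable.mono' (integrableOn_exp_mul_Ioi (neg_lt_zero.2 hz) 1)
    ((continuousOn_exp_neg_mul_div z).aestronglyMeasurable measurableSet_Ioi)
    (ae_restrict_of_forall_mem measurableSet_Ioi fun t ht => ?_)
  rw [norm_div, norm_exp_neg_mul_ofReal, norm_real]
  exact div_le_self (Real.exp_pos _).le ((le_of_lt ht).trans (le_abs_self t))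

theorem hasDerivAt_exp_neg_mul_div {t : ℝ} (ht : t ∈ Ioi 1) (u : ℂ) :
    HasDerivAt (fun u => exp (-u * t) / t) (-exp (-u * t)) u := by
  have ht0 := ofReal_ne_zero_of_one_lt ht
  refine (((hasDerivAt_neg u).mul_const (t : ℂ)).cexp.div_const (t : ℂ)).congr_deriv ?_
  field_simp

theorem hasDerivAt_Ei1 (hz : 0 < z.re) : HasDerivAt Ei1 (-exp (-z) / z) z := by
  have hhalf : z.re / 2 < z.re := half_lt_self hz
  have hbound : ∀ t ∈ Ioi (1 : ℝ), ∀ u ∈ {u : ℂ | z.re / 2 < u.re},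
      ‖-exp (-u * t)‖ ≤ Real.exp (-(z.re / 2) * t) := fun t ht u hu => by
    have ht' : 0 < t := one_pos.trans ht
    have hu' : z.re / 2 < u.re := hu
    rw [norm_neg, norm_exp_neg_mul_ofReal]
    gcongr
  have hderiv := (hasDerivAt_integral_of_dominated_loc_of_deriv_le
    (μ := volume.restrict (Ioi 1)) (F := fun u (t : ℝ) => exp (-u * t) / t)
    ((isOpen_lt continuous_const continuous_re).mem_nhds hhalf)
    (.of_forall fun u => (continuousOn_exp_neg_mul_div u).aestronglyMeasurable measurableSet_Ioi)
    (integrableOn_exp_neg_mul_div hz)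
    (Continuous.aestronglyMeasurable (by fun_prop))
    (ae_restrict_of_forall_mem measurableSet_Ioi hbound)
    (integrableOn_exp_mul_Ioi (by linarith) 1)
    (ae_restrict_of_forall_mem measurableSet_Ioi fun t ht u _ =>
      hasDerivAt_exp_neg_mul_div ht u)).2
  refine hderiv.congr_deriv ?_
  rw [integral_neg, integral_exp_mul_complex_Ioi (by simpa using hz) 1]
  simp [neg_div, div_neg]

theorem hasDerivAt_Ei1_comp {g : ℂ → ℂ} {c : ℂ} (hg : HasDerivAt g (c * g z) z)
    (hpos : 0 < (g z).re) : HasDerivAt (fun z => Ei1 (g z)) (-c * exp (-g z)) z := by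
  have hne : g z ≠ 0 := fun h => by simp [h] at hpos
  refine ((hasDerivAt_Ei1 hpos).comp z hg).congr_deriv ?_
  field_simp

end ExponentialIntegral

section TransferFunction

open Complex

variable {x y z : ℂ}

theorem dom_iff_segment : Dom x y ↔ ∀ z ∈ segment ℝ 0 x, 0 < (y * exp z).re := by
  simp only [mem_segment_zero, Dom, Set.mem_Icc]
  exact ⟨fun h => by rintro _ ⟨s, hs, rfl⟩; exact h s hs.1 hs.2, fun h s h0 h1 =>
    h _ ⟨s, ⟨h0, h1⟩, rfl⟩⟩

theorem Dom.mono (h : Dom x y) (hz : z ∈ segment ℝ 0 x) : Dom z y :=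
  dom_iff_segment.2 fun w hw => dom_iff_segment.1 h w <|
    (convex_segment 0 x).segment_subset (left_mem_segment ℝ 0 x) hz hw

theorem Dom.re_pos (h : Dom x y) : 0 < y.re := by
  simpa using h 0 le_rfl zero_le_one

theorem Dom.ne_zero (h : Dom x y) : y ≠ 0 := by
  rintro rfl
  exact h.re_pos.false

theorem Dom.char (h : Dom x y) (hz : z ∈ segment ℝ 0 x) : Dom z (y * exp (x - z)) := by
  obtain ⟨s, ⟨hs0, hs1⟩, rfl⟩ := mem_segment_zero.1 hz
  intro a ha0 ha1
  have hpoint := h (1 - s + a * s) (by nlinarith) (by nlinarith)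
  rw [mul_assoc, ← exp_add]
  convert hpoint using 4
  push_cast
  ring

theorem Dom.exists_convex_nhds (h : Dom x y) : ∃ C : Set ℂ, Convex ℝ C ∧ IsOpen C ∧ 0 ∈ C ∧ x ∈ C ∧
    ∀ z ∈ C, 0 < (y * exp z).re := by
  have hopen : IsOpen {z : ℂ | 0 < (y * exp z).re} := isOpen_lt continuous_const (by fun_prop)
  have hcompact : IsCompact (segment ℝ 0 x) := by
    rw [segment_eq_image]
    exact isCompact_Icc.image (by fun_prop)
  obtain ⟨δ, hδ, hsub⟩ := hcompact.exists_thickening_subset_open hopen (dom_iff_segment.1 h)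
  have hself := Metric.self_subset_thickening hδ (segment ℝ 0 x)
  exact ⟨Metric.thickening δ (segment ℝ 0 x), (convex_segment 0 x).thickening δ,
    Metric.isOpen_thickening, hself (left_mem_segment ℝ 0 x), hself (right_mem_segment ℝ 0 x), hsub⟩

theorem hasDerivAt_Ei1_mul_exp (h : 0 < (y * exp z).re) :
    HasDerivAt (fun z => Ei1 (y * exp z)) (-exp (-(y * exp z))) z := by
  have hY : HasDerivAt (fun z => y * exp z) (1 * (y * exp z)) z :=
    (one_mul (y * exp z)).symm ▸ (hasDerivAt_exp z).const_mul y
  exact (hasDerivAt_Ei1_comp hY h).congr_deriv (neg_one_mul _)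

/-- A primitive of `y² Ei(1, y eʳ) exp (y eʳ + 2r)` with respect to `r`, which evaluates the inner
integral in `T`. -/
noncomputable def innerPrim (y r : ℂ) : ℂ :=
  (y * exp r - 1) * (exp (y * exp r) * Ei1 (y * exp r)) + y * exp r - r

theorem hasDerivAt_innerPrim (h : 0 < (y * exp z).re) :
    HasDerivAt (innerPrim y) (y ^ 2 * (Ei1 (y * exp z) * exp (y * exp z + 2 * z))) z := by
  have hY : HasDerivAt (fun r => y * exp r) (y * exp z) z := (hasDerivAt_exp z).const_mul y
  refine ((((hY.sub_const 1).mul (hY.cexp.mul (hasDerivAt_Ei1_mul_exp h))).add hY).sub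
    (hasDerivAt_id z)).congr_deriv ?_
  have hinv : exp (y * exp z) * exp (-(y * exp z)) = 1 := by
    rw [← exp_add, add_neg_cancel, exp_zero]
  have hsq : exp (y * exp z + 2 * z) = exp (y * exp z) * exp z ^ 2 := by
    rw [exp_add, two_mul, exp_add, sq]
  rw [hsq, Pi.mul_apply]
  linear_combination (1 - y * exp z) * hinv

theorem sq_mul_segInt_Ei1 (h : Dom x y) :
    y ^ 2 * segInt x (fun r => Ei1 (y * exp r) * exp (y * exp r + 2 * r)) =
      innerPrim y x - innerPrim y 0 := by
  have hpos := dom_iff_segment.1 h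
  have hEi : ContinuousOn (fun r => Ei1 (y * exp r)) (segment ℝ 0 x) := fun r hr =>
    (hasDerivAt_Ei1_mul_exp (hpos r hr)).continuousAt.continuousWithinAt
  rw [← segInt_const_mul]
  exact segInt_eq_sub (fun r hr => hasDerivAt_innerPrim (hpos r hr)) (by fun_prop)

/-- The closed form of `T_xx(x, y) / y` on the domain of `T`. -/
noncomputable def txxClosed (x y : ℂ) : ℂ :=
  exp (y * exp x - y) * (2 * (y * exp x) - y - x) +
    (1 - y) * exp (y * exp x) * (Ei1 y - Ei1 (y * exp x))

theorem differentiableAt_txxClosed (h : 0 < (y * exp z).re) :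
    DifferentiableAt ℂ (fun z => txxClosed z y) z := by
  have hEi := (hasDerivAt_Ei1_mul_exp h).differentiableAt
  unfold txxClosed
  fun_prop

theorem T_eq_segInt (h : Dom x y) : T x y = segInt x fun t => (x - t) * (y * txxClosed t y) := by
  have hpos := dom_iff_segment.1 h
  have hEi : ContinuousOn (fun t => Ei1 (y * exp t)) (segment ℝ 0 x) := fun t ht =>
    (hasDerivAt_Ei1_mul_exp (hpos t ht)).continuousAt.continuousWithinAt
  have hP : ContinuousOn (innerPrim y) (segment ℝ 0 x) := fun t ht =>
    (hasDerivAt_innerPrim (hpos t ht)).continuousAt.continuousWithinAt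
  have hinner : y ^ 3 * segInt x (fun t => (x - t) * exp (y * exp t - y) *
      segInt t (fun r => Ei1 (y * exp r) * exp (y * exp r + 2 * r))) =
      segInt x fun t => y * ((x - t) * exp (y * exp t - y) * (innerPrim y t - innerPrim y 0)) := by
    rw [← segInt_const_mul]
    refine segInt_congr fun t ht => ?_
    linear_combination y * (x - t) * exp (y * exp t - y) * sq_mul_segInt_Ei1 (h.mono ht)
  rw [T, hinner, ← segInt_const_mul y, ← segInt_const_mul (y * (1 - y)),
    ← segInt_add (by fun_prop) (by fun_prop), ← segInt_add (by fun_prop) (by fun_prop)]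
  refine segInt_congr fun t _ => ?_
  have hexp : exp (y * exp t - y) * exp y = exp (y * exp t) := by rw [← exp_add, sub_add_cancel]
  simp only [innerPrim, txxClosed, exp_zero, mul_one]
  rw [← hexp]
  ring

theorem eventually_hasDerivAt_T (h : Dom x y) :
    ∃ T' : ℂ → ℂ, (∀ᶠ z in nhds x, HasDerivAt (fun s => T s y) (T' z) z) ∧
      HasDerivAt T' (y * txxClosed x y) x := by
  obtain ⟨C, hC, hCo, h0, hx, hpos⟩ := h.exists_convex_nhds
  have hdiff : DifferentiableOn ℂ (fun z => y * txxClosed z y) C := fun z hz =>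
    ((differentiableAt_txxClosed (hpos z hz)).const_mul y).differentiableWithinAt
  have hprim (z : ℂ) (hz : z ∈ C) := hasDerivAt_segInt hC hCo h0 hdiff hz
  have hprim_diff : DifferentiableOn ℂ (fun z => segInt z fun t => y * txxClosed t y) C :=
    fun z hz => (hprim z hz).differentiableAt.differentiableWithinAt
  have hT : Set.EqOn (fun s => T s y) (fun z => segInt z fun t => segInt t fun r =>
      y * txxClosed r y) C := fun z hz =>
    (T_eq_segInt (dom_iff_segment.2 fun w hw => hpos w (hC.segment_subset h0 hz hw))).trans
      (segInt_sub_mul hC hCo h0 hdiff hz)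
  refine ⟨_, ?_, hprim x hx⟩
  filter_upwards [hCo.mem_nhds hx] with z hz
  exact (hasDerivAt_segInt hC hCo h0 hprim_diff hz).congr_of_eventuallyEq
    (hT.eventuallyEq_of_mem (hCo.mem_nhds hz))

theorem analyticAt_T (h : Dom x y) : AnalyticAt ℂ (fun s => T s y) x := by
  obtain ⟨_, hT, -⟩ := eventually_hasDerivAt_T h
  exact analyticAt_iff_eventually_differentiableAt.2 (hT.mono fun _ hz => hz.differentiableAt)

theorem Txx_eq (h : Dom x y) : Txx x y = y * txxClosed x y := by
  obtain ⟨T', hT, hT'⟩ := eventually_hasDerivAt_T h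
  have hderiv : deriv (fun s => T s y) =ᶠ[nhds x] T' := hT.mono fun _ hz => hz.deriv
  rw [Txx, iteratedDeriv_succ, iteratedDeriv_one, hderiv.deriv_eq, hT'.deriv]

end TransferFunction

section Characteristics

open Complex

variable {x y : ℂ}

theorem mul_exp_sub_mul_exp (x y z : ℂ) : y * exp (x - z) * exp z = y * exp x := by
  rw [mul_assoc, ← exp_add, sub_add_cancel]

theorem hasDerivAt_Ei1_mul_exp_sub {z : ℂ} (h : 0 < (y * exp (x - z)).re) :
    HasDerivAt (fun z => Ei1 (y * exp (x - z))) (exp (-(y * exp (x - z)))) z := by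
  have hY : HasDerivAt (fun z => y * exp (x - z)) (-1 * (y * exp (x - z))) z :=
    (hasDerivAt_mul_exp_sub x y z).congr_deriv (neg_one_mul _).symm
  exact (hasDerivAt_Ei1_comp hY h).congr_deriv (by rw [neg_neg, one_mul])

theorem egf_stirlingCoeff_zero (y : ℂ) : egf stirlingCoeff 0 y = 1 := by
  rw [egf, tsum_eq_single (0, 0)]
  · simp [egfTerm, stirlingCoeff]
  · rintro ⟨_ | k, _ | n⟩ hp <;> simp_all [egfTerm, stirlingCoeff]

theorem egf_txxCoeff_zero (y : ℂ) : egf txxCoeff 0 y = y := by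
  have hrow (k : ℕ) : (txxCoeff - mulY stirlingCoeff) 0 k = 0 := by
    cases k <;> simp [txxCoeff, convMinCoeff, convCoeff, diagCoeff, mulY_zero, mulY_succ,
      convSumMin, convSum, stirlingConv]
  have hzero := egf_zero_left hrow y
  rwa [egf_sub txxCoeff_mem (mulY_mem stirlingCoeff_mem), egf_mulY stirlingCoeff_mem,
    egf_stirlingCoeff_zero, mul_one, sub_eq_zero] at hzero

theorem egf_stirlingCoeff (x y : ℂ) : egf stirlingCoeff x y = exp (y * exp x - y) := by
  have hconst := eq_of_hasDerivAt_zero (x := x)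
    (F := fun z => exp (y * exp (x - z)) * egf stirlingCoeff z (y * exp (x - z))) fun z _ => by
      refine ((hasDerivAt_mul_exp_sub x y z).cexp.mul
        (hasDerivAt_egf_char stirlingCoeff_mem x y z)).congr_deriv ?_
      rw [charDeriv_stirlingCoeff, egf_mulY stirlingCoeff_mem]
      ring
  simp only [sub_self, sub_zero, exp_zero, mul_one, egf_stirlingCoeff_zero] at hconst
  rw [exp_sub, ← hconst, mul_div_cancel_left₀ _ (exp_ne_zero _)]

theorem egf_diagCoeff (h : Dom x y) :
    egf diagCoeff x y = y * exp (y * exp x) * (Ei1 y - Ei1 (y * exp x)) := by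
  have hconst := eq_of_hasDerivAt_zero (x := x)
    (F := fun z => exp z * egf diagCoeff z (y * exp (x - z)) -
      y * exp x * exp (y * exp x) * Ei1 (y * exp (x - z))) fun z hz => by
      refine (((hasDerivAt_exp z).mul (hasDerivAt_egf_char diagCoeff_mem x y z)).sub
        ((hasDerivAt_Ei1_mul_exp_sub (h.char hz).re_pos).const_mul _)).congr_deriv ?_
      rw [charDeriv_diagCoeff, neg_add_eq_sub, egf_sub (mulY_mem stirlingCoeff_mem) diagCoeff_mem,
        egf_mulY stirlingCoeff_mem, egf_stirlingCoeff, mul_exp_sub_mul_exp,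
        sub_eq_add_neg (y * exp x), exp_add, ← mul_exp_sub_mul_exp x y z]
      ring
  have hzero : egf diagCoeff 0 (y * exp x) = 0 := egf_zero_left (fun k => by
    cases k <;> simp [diagCoeff, mulY_zero, mulY_succ, stirlingConv]) _
  simp only [sub_self, sub_zero, exp_zero, mul_one, hzero] at hconst
  refine mul_left_cancel₀ (exp_ne_zero x) ?_
  linear_combination hconst

theorem egf_txxCoeff (h : Dom x y) : egf txxCoeff x y = txxClosed x y := by
  have hconst := eq_of_hasDerivAt_zero (x := x)
    (F := fun z => exp (y * exp (x - z)) * egf txxCoeff z (y * exp (x - z)) -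
      exp (y * exp x) * ((2 * (y * exp x) - y * exp (x - z) - z) +
        (1 - y * exp (x - z)) * exp (y * exp (x - z)) *
          (Ei1 (y * exp (x - z)) - Ei1 (y * exp x)))) fun z hz => by
      have hY := hasDerivAt_mul_exp_sub x y z
      have hEi := hasDerivAt_Ei1_mul_exp_sub (h.char hz).re_pos
      refine ((hY.cexp.mul (hasDerivAt_egf_char txxCoeff_mem x y z)).sub
        ((((hY.const_sub _).sub (hasDerivAt_id z)).add (((hY.const_sub 1).mul hY.cexp).mul
          (hEi.sub_const _))).const_mul _)).congr_deriv ?_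
      have hinv : exp (y * exp (x - z)) * exp (-(y * exp (x - z))) = 1 := by
        rw [← exp_add, add_neg_cancel, exp_zero]
      rw [charDeriv_txxCoeff, egf_add (mulY_mem txxCoeff_mem) (mulY_mem diagCoeff_mem),
        egf_mulY txxCoeff_mem, egf_mulY diagCoeff_mem, egf_diagCoeff (h.char hz),
        mul_exp_sub_mul_exp, Pi.mul_apply]
      linear_combination -exp (y * exp x) * (1 - y * exp (x - z)) * hinv
  simp only [sub_self, sub_zero, exp_zero, mul_one, egf_txxCoeff_zero] at hconst
  have hexp : exp y * exp (y * exp x - y) = exp (y * exp x) := by rw [← exp_add, add_sub_cancel]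
  refine mul_left_cancel₀ (exp_ne_zero y) ?_
  rw [txxClosed]
  linear_combination hconst - (2 * (y * exp x) - y - x) * hexp

-- Along a characteristic, `charDeriv_charDeriv_totalCoeff` is a linear equation of first order for
-- `charDeriv totalCoeff`, with integrating factor `exp (y * exp (x - r) + r)`.
theorem segInt_egf_txxCoeff (x y t : ℂ) :
    segInt t (fun r => exp (y * exp (x - r) + r) * ((1 + y * exp (x - r)) *
      egf txxCoeff r (y * exp (x - r)))) =
      exp (y * exp (x - t) + t) * egf (charDeriv totalCoeff) t (y * exp (x - t)) := by
  have hzero : egf (charDeriv totalCoeff) 0 (y * exp x) = 0 := egf_zero_left (fun k => by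
    simp [charDeriv_apply, totalCoeff, totalV_of_le_one]) _
  have hderiv (z : ℂ) := ((hasDerivAt_mul_exp_sub x y z).add (hasDerivAt_id z)).cexp.mul
    (hasDerivAt_egf_char (charDeriv_mem totalCoeff_mem) x y z)
  have hcont : Continuous fun r => egf txxCoeff r (y * exp (x - r)) :=
    continuous_iff_continuousAt.2 fun r =>
      (hasDerivAt_egf_char txxCoeff_mem x y r).continuousAt
  refine (segInt_eq_sub (fun z _ => (hderiv z).congr_deriv ?_) (by fun_prop)).trans ?_
  · rw [charDeriv_charDeriv_totalCoeff,
      egf_add (sub_mem (mulY_mem (charDeriv_mem totalCoeff_mem)) (charDeriv_mem totalCoeff_mem))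
        (add_mem txxCoeff_mem (mulY_mem txxCoeff_mem)),
      egf_sub (mulY_mem (charDeriv_mem totalCoeff_mem)) (charDeriv_mem totalCoeff_mem),
      egf_add txxCoeff_mem (mulY_mem txxCoeff_mem), egf_mulY txxCoeff_mem,
      egf_mulY (charDeriv_mem totalCoeff_mem)]
    simp only [Pi.add_apply, id]
    ring
  · simp [hzero]

theorem egf_totalCoeff (x y : ℂ) : egf totalCoeff x y =
    segInt x fun t => egf (charDeriv totalCoeff) t (y * exp (x - t)) := by
  have hzero : egf totalCoeff 0 (y * exp x) = 0 := egf_zero_left (fun k => by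
    simp [totalCoeff, totalV_of_le_one]) _
  rw [segInt_eq_sub (fun z _ => hasDerivAt_egf_char totalCoeff_mem x y z) fun z _ =>
    (hasDerivAt_egf_char (charDeriv_mem totalCoeff_mem) x y z).continuousAt.continuousWithinAt]
  simp [hzero]

theorem segInt_Txx (h : Dom x y) {t : ℂ} (ht : t ∈ segment ℝ 0 x) :
    segInt t (fun r => exp (y * exp (x - r) + r) * (exp (r - x) + y) * Txx r (y * exp (x - r))) =
      y * (exp (y * exp (x - t) + t) * egf (charDeriv totalCoeff) t (y * exp (x - t))) := by
  rw [← segInt_egf_txxCoeff, ← segInt_const_mul]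
  refine segInt_congr fun r hr => ?_
  have hdom := h.char ((convex_segment 0 x).segment_subset (left_mem_segment ℝ 0 x) ht hr)
  have hexp : exp (r - x) * exp (x - r) = 1 := by
    rw [← exp_add, sub_add_sub_cancel, sub_self, exp_zero]
  simp only [Txx_eq hdom, egf_txxCoeff hdom]
  linear_combination exp (y * exp (x - r) + r) * y * txxClosed r (y * exp (x - r)) * hexp

theorem Q_eq_segInt (h : Dom x y) :
    Q x y = 1 / y * segInt x (fun t => exp (-y * exp (x - t) - t) *
      segInt t (fun r => exp (y * exp (x - r) + r) * (exp (r - x) + y) *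
        Txx r (y * exp (x - r)))) := by
  rw [Q_eq_egf, egf_totalCoeff, ← segInt_const_mul]
  refine segInt_congr fun t ht => ?_
  have hexp : exp (-y * exp (x - t) - t) * exp (y * exp (x - t) + t) = 1 := by
    rw [← exp_add, neg_mul, neg_sub_left, add_comm t, neg_add_cancel, exp_zero]
  rw [segInt_Txx h ht, mul_left_comm _ y, ← mul_assoc _ (exp (y * _ + t)), hexp, one_mul,
    ← mul_assoc, one_div_mul_cancel h.ne_zero, one_mul]

end Characteristics

end VisRGS

theorem theorem1 :
    (∀ x y : ℂ, Summable fun p : ℕ × ℕ => VisRGS.qTerm x y (p.1 + 1) p.2) ∧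
    ∀ x y : ℂ, VisRGS.Dom x y →
      AnalyticAt ℂ (fun s => VisRGS.T s y) x ∧
      VisRGS.Q x y =
        1 / y * VisRGS.segInt x (fun t =>
          Complex.exp (-y * Complex.exp (x - t) - t) *
          VisRGS.segInt t (fun r =>
            Complex.exp (y * Complex.exp (x - r) + r) * (Complex.exp (r - x) + y) *
              VisRGS.Txx r (y * Complex.exp (x - r)))) :=
  ⟨VisRGS.summable_qTerm, fun _ _ h => ⟨VisRGS.analyticAt_T h, VisRGS.Q_eq_segInt h⟩⟩
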